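/- Let $n\ge 1$, $R\in(0,+\infty]$, and let $\xi\in C^\infty([0,R))$ satisfy $\xi>0$ on $(0,R)$, $\xi^{(2k)}(0)=0$ for all $k\ge 0$, and $\xi'(0)=1$. Let $P=[0,R)\times_\xi\mathbb S^{n-1}$ be the $n$-dimensional model manifold with pole $o$ and metric $dr^2+\xi(r)^2d\theta^2$. Let $c>0$ and $b\in\mathbb R$ be constants and define $$\psi(r)=c\,\frac{n-1}{2}\log\frac{\xi(r)}{r}+b\quad (0<r<R),\qquad \psi(0)=b .$$ Then $\psi$ is smooth and even (that is, $r\mapsto\psi(|r|)$ is smooth on $(-R,R)$) and defines a smooth radial function on $P$. Let $M=P\times_{e^{-\psi}}\mathbb R$ be the warped product with metric $g_P+e^{-2\psi}ds^2$ and Killing field $Y=\partial_s$. Fix $0<r_0<R$, put $H_0=-1/r_0$, $\Omega=B^P_{r_0}(o)$ and $$u(r)=\int_r^{r_0}\frac{-H_0\,\tau}{\sqrt{1-H_0^2\tau^2}}\,e^{\psi(\tau)}\,d\tau ,\qquad 0\le r\le r_0 .$$ This integral converges, and $u$ defines a smooth radial function on $\Omega$. (i) If $c=1$, i.e. $e^{-2\psi}\xi^{n-1}=e^{-2b}r^{n-1}$,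 then the Killing graph $\{(x,u(r(x))):x\in\Omega\}\subset M$ has constant weighted mean curvature $H_\psi=H_0$ with respect to its upward pointing unit normal $\mathcal N$ (the one with $\langle\mathcal N,Y\rangle>0$). Here $H_\psi=H+\frac1n\langle\nabla\psi,\mathcal N\rangle$, where $nH$ is the trace of the second fundamental form $\langle\nabla_XX',\mathcal N\rangle$. (ii) For all $r\in[0,r_0]$, $$0\le e^{-\psi(r)}u(r)\le\frac{\max_{[0,r_0]}e^{-\psi}}{\min_{[0,r_0]}e^{-\psi}}\cdot\frac1{|H_0|}=\frac{e^{\sup_\Omega\psi-\inf_\Omega\psi}}{|H_0|}.$$ -/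

import Mathlib

open Set
open scoped ContDiff

noncomputable section

namespace KillingGraph

/-! ### Extrinsic geometry of a parametrized hypersurface in a global chart

A Riemannian metric on (an open subset of) a normed space `V` is written as a function
`G : V → V → V → ℝ`, where `G p a b = ⟨a, b⟩_p`. -/

section General

variable {V : Type*} [NormedAddCommGroup V] [NormedSpace ℝ V]

/-- Christoffel symbols of the first kind of `G` (Koszul formula on constant vector fields):
`⟨∇_a b, c⟩_p` for the Levi-Civita connection `∇` of `G` and constant vector fields `a, b, c`. -/
def christoffel (G : V → V → V → ℝ) (p a b c : V) : ℝ :=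
  (1 / 2) * (fderiv ℝ (fun q => G q b c) p a + fderiv ℝ (fun q => G q a c) p b
    - fderiv ℝ (fun q => G q a b) p c)

variable {n : ℕ}

/-- The metric induced by `G` through the map `F`: `⟨dF v, dF w⟩`. -/
def inducedMetric (G : V → V → V → ℝ) (F : EuclideanSpace ℝ (Fin n) → V)
    (x v w : EuclideanSpace ℝ (Fin n)) : ℝ :=
  G (F x) (fderiv ℝ F x v) (fderiv ℝ F x w)

/-- The scalar second fundamental form `⟨∇_{dF v} (dF w), N⟩` of the immersion `F` at `x`,
with respect to the normal vector `N` at `F x`; here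
`∇_{dF v} (dF w) = D²F(v, w) + Γ(dF v, dF w)`. -/
def secondFundamentalForm (G : V → V → V → ℝ) (F : EuclideanSpace ℝ (Fin n) → V)
    (x : EuclideanSpace ℝ (Fin n)) (N : V) (v w : EuclideanSpace ℝ (Fin n)) : ℝ :=
  G (F x) (fderiv ℝ (fun y => fderiv ℝ F y w) x v) N
    + christoffel G (F x) (fderiv ℝ F x v) (fderiv ℝ F x w) N

/-- The (normalized) mean curvature: `1/n` times the trace of the second fundamental form with
respect to the induced metric. -/
def meanCurvature (G : V → V → V → ℝ) (F : EuclideanSpace ℝ (Fin n) → V)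
    (x : EuclideanSpace ℝ (Fin n)) (N : V) : ℝ :=
  (1 / (n : ℝ)) *
    ((Matrix.of fun i j : Fin n => inducedMetric G F x
        (EuclideanSpace.single i (1 : ℝ)) (EuclideanSpace.single j (1 : ℝ)))⁻¹ *
      (Matrix.of fun i j : Fin n => secondFundamentalForm G F x N
        (EuclideanSpace.single i (1 : ℝ)) (EuclideanSpace.single j (1 : ℝ)))).trace

/-- The `f`-weighted mean curvature `H_f = H + (1/n) ⟨∇f, N⟩`, where `⟨∇f, N⟩ = df(N)`. -/
def weightedMeanCurvature (G : V → V → V → ℝ) (f : V → ℝ)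
    (F : EuclideanSpace ℝ (Fin n) → V) (x : EuclideanSpace ℝ (Fin n)) (N : V) : ℝ :=
  meanCurvature G F x N + (1 / (n : ℝ)) * fderiv ℝ f (F x) N

end General

/-! ### Model manifolds -/

/-- The interval `[0, R)`, with `R ∈ (0, +∞]`. -/
def radialInterval (R : EReal) : Set ℝ := {r | 0 ≤ r ∧ (r : EReal) < R}

/-- Warping functions of model manifolds: `ξ ∈ C^∞([0, R))`, `ξ > 0` on `(0, R)`,
`ξ^{(2k)}(0) = 0` for all `k ≥ 0`, `ξ'(0) = 1`. -/
structure IsModelWarping (R : EReal) (ξ : ℝ → ℝ) : Prop where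
  smooth : ContDiffOn ℝ ∞ ξ (radialInterval R)
  pos : ∀ r : ℝ, 0 < r → (r : EReal) < R → 0 < ξ r
  even_deriv : ∀ k : ℕ, iteratedDerivWithin (2 * k) ξ (radialInterval R) 0 = 0
  deriv_one : derivWithin ξ (radialInterval R) 0 = 1

/-- The model manifold `P = [0, R) ×_ξ 𝕊^{n-1}` as a set: the ball of radius `R` about the
pole `o = 0` in `ℝⁿ`, the point with Gaussian coordinates `(r, θ)` being `x = r θ`. -/
def modelBall (n : ℕ) (R : EReal) : Set (EuclideanSpace ℝ (Fin n)) :=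
  {x | ((‖x‖ : ℝ) : EReal) < R}

/-- The metric `dr² + ξ(r)² dθ²` of the model manifold, at `x = r θ`.
The radial component of `v` is `⟨x, v⟩ / r`, and the Euclidean metric is `dr² + r² dθ²`. -/
def modelMetric {n : ℕ} (ξ : ℝ → ℝ) (x v w : EuclideanSpace ℝ (Fin n)) : ℝ :=
  open Classical in
  if x = 0 then inner ℝ v w
  else (inner ℝ x v / ‖x‖) * (inner ℝ x w / ‖x‖)
    + (ξ ‖x‖ / ‖x‖) ^ 2 * (inner ℝ v w - (inner ℝ x v / ‖x‖) * (inner ℝ x w / ‖x‖))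

/-- In polar coordinates `x = r θ`, the metric is `dr² + ξ(r)² dθ²`. -/
theorem modelMetric_polar {n : ℕ} (ξ : ℝ → ℝ) (r a b : ℝ) (hr : 0 < r)
    (θ v w : EuclideanSpace ℝ (Fin n)) (hθ : ‖θ‖ = 1)
    (hv : inner ℝ θ v = 0) (hw : inner ℝ θ w = 0) :
    modelMetric ξ (r • θ) (a • θ + r • v) (b • θ + r • w)
      = a * b + ξ r ^ 2 * inner ℝ v w := by
  have h0 : r • θ ≠ 0 := by
    intro h
    have h1 := congrArg norm h
    rw [norm_smul, hθ] at h1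
    simp at h1
    exact hr.ne' h1
  have hn : ‖r • θ‖ = r := by
    rw [norm_smul, hθ, Real.norm_eq_abs, abs_of_pos hr, mul_one]
  have hθθ : inner ℝ θ θ = (1 : ℝ) := by rw [real_inner_self_eq_norm_sq, hθ]; norm_num
  have hv' : inner ℝ v θ = (0 : ℝ) := by rw [real_inner_comm]; exact hv
  rw [modelMetric, if_neg h0, hn]
  simp only [inner_add_left, inner_add_right, real_inner_smul_left, real_inner_smul_right,
    hθθ, hv, hv', hw]
  field_simp
  ring

/-! ### Killing graphs -/

/-- The metric `g_P + e^{-2ψ} ds²` of the warped product `M = P ×_{e^{-ψ}} ℝ`, for a model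
manifold `P` and a radial function `ψ = ψ(r)`. The Killing field is `Y = ∂_s = (0, 1)`. -/
def ambientMetric {n : ℕ} (ξ ψ : ℝ → ℝ) (p a b : EuclideanSpace ℝ (Fin n) × ℝ) : ℝ :=
  modelMetric ξ p.1 a.1 b.1 + Real.exp (-2 * ψ ‖p.1‖) * (a.2 * b.2)

/-- The parametrization `x ↦ (x, u(r(x)))` of the Killing graph of a radial function `u`. -/
def graphMap {n : ℕ} (u : ℝ → ℝ) (x : EuclideanSpace ℝ (Fin n)) :
    EuclideanSpace ℝ (Fin n) × ℝ := (x, u ‖x‖)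

/-- `N` is the upward pointing unit normal at the point of the Killing graph of `u` over `x`:
it is a unit vector, orthogonal to the graph, with `⟨N, Y⟩ > 0`. -/
structure IsUpwardUnitNormal {n : ℕ} (ξ ψ u : ℝ → ℝ) (x : EuclideanSpace ℝ (Fin n))
    (N : EuclideanSpace ℝ (Fin n) × ℝ) : Prop where
  unit : ambientMetric ξ ψ (graphMap u x) N N = 1
  normal : ∀ v, ambientMetric ξ ψ (graphMap u x) N (fderiv ℝ (graphMap u) x v) = 0
  upward : 0 < ambientMetric ξ ψ (graphMap u x) N (0, 1)

/-- The weighted mean curvature `H_ψ` of the Killing graph of the radial function `u` in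
`M = P ×_{e^{-ψ}} ℝ`, at the point over `x`, with respect to the unit normal `N`. -/
def graphWeightedMeanCurvature {n : ℕ} (ξ ψ u : ℝ → ℝ) (x : EuclideanSpace ℝ (Fin n))
    (N : EuclideanSpace ℝ (Fin n) × ℝ) : ℝ :=
  weightedMeanCurvature (ambientMetric ξ ψ) (fun p => ψ ‖p.1‖) (graphMap u) x N

/-! ### The example -/

/-- `ψ(r) = c ((n-1)/2) log(ξ(r)/r) + b` for `r ≠ 0`, and `ψ(0) = b`. -/
def examplePotential (n : ℕ) (c b : ℝ) (ξ : ℝ → ℝ) (r : ℝ) : ℝ :=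
  open Classical in
  if r = 0 then b else c * (((n : ℝ) - 1) / 2 * Real.log (ξ r / r)) + b

/-- The integrand `-H₀ τ e^{ψ(τ)} / √(1 - H₀² τ²)`. -/
def heightIntegrand (H₀ : ℝ) (ψ : ℝ → ℝ) (τ : ℝ) : ℝ :=
  -H₀ * τ / Real.sqrt (1 - H₀ ^ 2 * τ ^ 2) * Real.exp (ψ τ)

/-- `u(r) = ∫_r^{r₀} -H₀ τ e^{ψ(τ)} / √(1 - H₀² τ²) dτ`. -/
def exampleHeight (H₀ r₀ : ℝ) (ψ : ℝ → ℝ) (r : ℝ) : ℝ :=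
  ∫ τ in r..r₀, heightIntegrand H₀ ψ τ

end KillingGraph

end

/-! The proof works with `t = r²`, so that the pole becomes an ordinary one-sided endpoint. By
Hadamard's lemma and Whitney's theorem on even functions, `ξ r = r * a (r ^ 2)` with `a` smooth,
positive and `a 0 = 1`. Hence `ψ` is a smooth function `Ψ` of `r²`. The substitution `t = τ²`
likewise turns the height into a smooth function of `r²` with slope `V = H₀ e^Ψ / (2 √(1 - H₀² t))`.
Composing with `‖x‖ ^ 2` gives smoothness on `P` and on `Ω`.

In Cartesian coordinates the metric of `P` is `α ⟨·,·⟩ + β ⟨x,·⟩²` with `α = a²` and `α + β t = 1`,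
since radial lines have unit speed. The upward unit normal is `N = (-H₀ x, e^ψ √(1 - H₀² r²))`: its
part along `P` is that of a Euclidean hemisphere of radius `r₀`. Both fundamental forms combine
`⟨·,·⟩` and `⟨x,·⟩²`, so the trace splits into `n - 1` spherical directions and a radial one. For `c
= 1`, where `4 α Ψ' = (n - 1) α'`, the spherical directions give `(n - 1) H₀ + 4 Ψ' H₀ t` and the
radial one gives `H₀ - 2 Ψ' H₀ t`. The term `dψ(N) = -2 Ψ' H₀ t` cancels the excess, leaving `n H₀`.
This is `graphWeightedMeanCurvature_eq`.

For the height estimate, `e^ψ` is bounded by its maximum and the remaining integrand has the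
primitive `√(1 - H₀² τ²) / H₀`, so its integral is at most `1 / |H₀|`. -/

namespace KillingGraph

open Filter Topology MeasureTheory

/-! ### Smooth functions on initial intervals -/

/-- A set of the form `[0, a)` with `a ∈ (0, +∞]`. -/
structure IsInitialInterval (S : Set ℝ) : Prop where
  zero_mem : (0 : ℝ) ∈ S
  nonneg : ∀ r ∈ S, 0 ≤ r
  down : ∀ r ∈ S, ∀ s, 0 ≤ s → s ≤ r → s ∈ S
  exists_gt : ∀ r ∈ S, ∃ r' ∈ S, r < r'

namespace IsInitialInterval

variable {S : Set ℝ}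

theorem Icc_subset (hS : IsInitialInterval S) {r : ℝ} (hr : r ∈ S) : Icc 0 r ⊆ S :=
  fun _ hs => hS.down r hr _ hs.1 hs.2

theorem mem_nhds (hS : IsInitialInterval S) {r : ℝ} (hr : r ∈ S) (h0 : 0 < r) : S ∈ 𝓝 r := by
  obtain ⟨r', hr', h⟩ := hS.exists_gt r hr
  exact mem_of_superset (Icc_mem_nhds h0 h) (hS.Icc_subset hr')

theorem convex (hS : IsInitialInterval S) : Convex ℝ S := by
  refine OrdConnected.convex ⟨fun a ha b hb x hx => ?_⟩
  exact hS.down b hb x ((hS.nonneg a ha).trans hx.1) hx.2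

theorem uniqueDiffOn (hS : IsInitialInterval S) : UniqueDiffOn ℝ S := by
  obtain ⟨r', hr', h⟩ := hS.exists_gt 0 hS.zero_mem
  refine uniqueDiffOn_convex hS.convex ⟨r' / 2, mem_interior_iff_mem_nhds.2 ?_⟩
  exact mem_of_superset (Icc_mem_nhds (by linarith) (by linarith)) (hS.Icc_subset hr')

/-- The image of an initial interval under `r ↦ r²`. -/
theorem sqrt_preimage (hS : IsInitialInterval S) :
    IsInitialInterval {t | 0 ≤ t ∧ Real.sqrt t ∈ S} where
  zero_mem := ⟨le_rfl, by simpa using hS.zero_mem⟩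
  nonneg := fun _ h => h.1
  down := fun r h s hs hsr => ⟨hs, hS.down _ h.2 _ (Real.sqrt_nonneg _) (Real.sqrt_le_sqrt hsr)⟩
  exists_gt := fun r h => by
    obtain ⟨r', hr', hlt⟩ := hS.exists_gt _ h.2
    have h0 : 0 ≤ r' := (Real.sqrt_nonneg _).trans hlt.le
    refine ⟨r' ^ 2, ⟨sq_nonneg _, by rwa [Real.sqrt_sq h0]⟩, ?_⟩
    exact (Real.sqrt_lt' (by linarith [Real.sqrt_nonneg r])).1 hlt

end IsInitialInterval

theorem isInitialInterval_radialInterval {R : EReal} (hR : 0 < R) :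
    IsInitialInterval (radialInterval R) where
  zero_mem := ⟨le_rfl, by simpa using hR⟩
  nonneg := fun _ h => h.1
  down := fun r h s hs hsr => ⟨hs, (EReal.coe_le_coe_iff.2 hsr).trans_lt h.2⟩
  exists_gt := fun r h => by
    obtain ⟨r', h1, h2⟩ := EReal.lt_iff_exists_real_btwn.1 h.2
    have h1 := EReal.coe_lt_coe_iff.1 h1
    exact ⟨r', ⟨h.1.trans h1.le, h2⟩, h1⟩

theorem isInitialInterval_Ico {a : ℝ} (ha : 0 < a) : IsInitialInterval (Ico 0 a) where
  zero_mem := ⟨le_rfl, ha⟩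
  nonneg := fun _ h => h.1
  down := fun _ h _ hs hsr => ⟨hs, hsr.trans_lt h.2⟩
  exists_gt := fun r h => by
    obtain ⟨r', h1, h2⟩ := exists_between h.2
    exact ⟨r', ⟨h.1.trans h1.le, h2⟩, h1⟩

/-- The weighted mean `∫₀¹ sᵏ F(s r) ds`. -/
noncomputable def dilationMean (k : ℕ) (F : ℝ → ℝ) (r : ℝ) : ℝ :=
  ∫ s in (0 : ℝ)..1, s ^ k * F (s * r)

theorem dilationMean_zero (k : ℕ) (F : ℝ → ℝ) : dilationMean k F 0 = F 0 / (k + 1) := by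
  simp [dilationMean, div_eq_inv_mul]

theorem mul_dilationMean_zero (F : ℝ → ℝ) (r : ℝ) :
    r * dilationMean 0 F r = ∫ t in (0 : ℝ)..r, F t := by
  simp [dilationMean, intervalIntegral.mul_integral_comp_mul_right]

theorem dilationMean_congr {k : ℕ} {F G : ℝ → ℝ} {r : ℝ} (hr : 0 ≤ r)
    (h : EqOn F G (Icc 0 r)) : dilationMean k F r = dilationMean k G r := by
  refine intervalIntegral.integral_congr fun s hs => ?_
  rw [uIcc_of_le zero_le_one] at hs
  rw [h ⟨mul_nonneg hs.1 hr, mul_le_of_le_one_left hr hs.2⟩]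

theorem continuous_dilationMean (k : ℕ) {F : ℝ → ℝ} (hF : Continuous F) :
    Continuous (dilationMean k F) := by
  unfold dilationMean
  exact intervalIntegral.continuous_parametric_intervalIntegral_of_continuous (by fun_prop)
    continuous_const

/-- Differentiation under the integral sign: each derivative releases one factor `s`, which is why
the exponent `k` is a parameter. On a bounded neighbourhood a bound for `F'` dominates. -/
theorem hasDerivAt_dilationMean (k : ℕ) {F F' : ℝ → ℝ} (hF' : Continuous F')
    (h : ∀ x, HasDerivAt F (F' x) x) (r : ℝ) :
    HasDerivAt (dilationMean k F) (dilationMean (k + 1) F' r) r := by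
  have hF : Continuous F := continuous_iff_continuousAt.2 fun x => (h x).continuousAt
  obtain ⟨C, hC⟩ := (isCompact_Icc (a := -(|r| + 1)) (b := |r| + 1)).exists_bound_of_continuousOn
    hF'.continuousOn
  have hs : Metric.ball r 1 ∈ 𝓝 r := Metric.ball_mem_nhds r one_pos
  refine (intervalIntegral.hasDerivAt_integral_of_dominated_loc_of_deriv_le
    (F := fun x s => s ^ k * F (s * x)) (F' := fun x s => s ^ (k + 1) * F' (s * x))
    (bound := fun _ => C) (μ := volume) (a := 0) (b := 1) hs ?_ ?_ ?_ ?_ ?_ ?_).2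
  · exact Eventually.of_forall fun x => Continuous.aestronglyMeasurable (by fun_prop)
  · exact Continuous.intervalIntegrable (by fun_prop) _ _
  · exact Continuous.aestronglyMeasurable (by fun_prop)
  · refine Eventually.of_forall fun s hs x hx => ?_
    rw [uIoc_of_le zero_le_one] at hs
    have hx : |x| ≤ |r| + 1 := by
      have h1 : |x - r| < 1 := hx
      have := abs_sub_abs_le_abs_sub x r
      linarith
    have h1 : |s * x| ≤ |r| + 1 := by
      rw [abs_mul, abs_of_pos hs.1]
      exact (mul_le_of_le_one_left (abs_nonneg _) hs.2).trans hx
    have h2 := hC (s * x) (abs_le.1 h1)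
    rw [norm_mul, norm_pow, Real.norm_of_nonneg hs.1.le]
    exact (mul_le_of_le_one_left (norm_nonneg _) (pow_le_one₀ hs.1.le hs.2)).trans h2
  · simp
  · refine Eventually.of_forall fun s _ x _ => ?_
    have := ((h (s * x)).comp x ((hasDerivAt_id x).const_mul s)).const_mul (s ^ k)
    refine this.congr_deriv ?_
    ring

variable {S : Set ℝ}

theorem nhdsWithin_Icc_le (hS : IsInitialInterval S) {r r' : ℝ} (hrr' : r < r') :
    Icc 0 r' ∈ 𝓝[S] r := by
  filter_upwards [self_mem_nhdsWithin, mem_nhdsWithin_of_mem_nhds (Iic_mem_nhds hrr')] with x h1 h2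
  exact ⟨hS.nonneg x h1, h2⟩

theorem continuousOn_dilationMean (hS : IsInitialInterval S) (k : ℕ) {F : ℝ → ℝ}
    (hF : ContinuousOn F S) : ContinuousOn (dilationMean k F) S := by
  intro r hr
  obtain ⟨r', hr', hlt⟩ := hS.exists_gt r hr
  have h0 : 0 ≤ r' := hS.nonneg _ hr'
  have hc : Continuous (IccExtend h0 ((Icc 0 r').domRestrict F)) :=
    (hF.mono (hS.Icc_subset hr')).domRestrict.Icc_extend'
  have key : ∀ x ∈ Icc 0 r',
      dilationMean k F x = dilationMean k (IccExtend h0 ((Icc 0 r').domRestrict F)) x := by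
    intro x hx
    refine dilationMean_congr hx.1 fun y hy => ?_
    rw [IccExtend_of_mem h0 _ ⟨hy.1, hy.2.trans hx.2⟩]
    rfl
  refine ((continuous_dilationMean k hc).continuousWithinAt).congr_of_eventuallyEq ?_
    (key r ⟨hS.nonneg r hr, hlt.le⟩)
  filter_upwards [nhdsWithin_Icc_le hS hlt] with x hx using key x hx

/-- Only values on `[0, r']` matter near `r < r'`. There `F'` is extended by constants to a
continuous `D`, and `F` agrees with a primitive `E` of `D`, so the global statement applies. -/
theorem hasDerivWithinAt_dilationMean (hS : IsInitialInterval S) (k : ℕ) {F F' : ℝ → ℝ}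
    (hF' : ContinuousOn F' S) (h : ∀ x ∈ S, HasDerivWithinAt F (F' x) S x) {r : ℝ} (hr : r ∈ S) :
    HasDerivWithinAt (dilationMean k F) (dilationMean (k + 1) F' r) S r := by
  obtain ⟨r', hr', hlt⟩ := hS.exists_gt r hr
  have h0 : 0 ≤ r' := hS.nonneg _ hr'
  set D : ℝ → ℝ := IccExtend h0 ((Icc 0 r').domRestrict F') with hD
  have hDc : Continuous D := (hF'.mono (hS.Icc_subset hr')).domRestrict.Icc_extend'
  have hDe : ∀ y ∈ Icc 0 r', D y = F' y := fun y hy => by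
    rw [hD, IccExtend_of_mem h0 _ hy]; rfl
  set E : ℝ → ℝ := fun x => F 0 + ∫ y in (0 : ℝ)..x, D y with hE
  have hEd : ∀ x, HasDerivAt E (D x) x := fun x =>
    (intervalIntegral.integral_hasDerivAt_right (hDc.intervalIntegrable _ _)
      (hDc.stronglyMeasurableAtFilter _ _) hDc.continuousAt).const_add _
  have hEe : ∀ x ∈ Icc 0 r', F x = E x := by
    intro x hx
    have hsub : Icc 0 x ⊆ S := (Icc_subset_Icc_right hx.2).trans (hS.Icc_subset hr')
    have := intervalIntegral.integral_eq_sub_of_hasDerivAt_of_le (f := F) (f' := D) hx.1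
      (fun y hy => ((h y (hsub hy)).continuousWithinAt).mono hsub)
      (fun y hy => by
        rw [hDe y ⟨hy.1.le, hy.2.le.trans hx.2⟩]
        have hyS := hsub ⟨hy.1.le, hy.2.le⟩
        exact (h y hyS).hasDerivAt (hS.mem_nhds hyS hy.1))
      (hDc.intervalIntegrable _ _)
    rw [hE]
    simp only
    rw [this]
    ring
  have key : ∀ x ∈ Icc 0 r', dilationMean k F x = dilationMean k E x := fun x hx =>
    dilationMean_congr hx.1 fun y hy => hEe y ⟨hy.1, hy.2.trans hx.2⟩
  have hr0 := hS.nonneg r hr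
  have e : dilationMean (k + 1) F' r = dilationMean (k + 1) D r :=
    dilationMean_congr hr0 fun y hy => (hDe y ⟨hy.1, hy.2.trans hlt.le⟩).symm
  rw [e]
  refine ((hasDerivAt_dilationMean k hDc hEd r).hasDerivWithinAt).congr_of_eventuallyEq ?_
    (key r ⟨hr0, hlt.le⟩)
  filter_upwards [nhdsWithin_Icc_le hS hlt] with x hx using key x hx

theorem hasDerivWithinAt_of_contDiffOn {F : ℝ → ℝ} (hF : ContDiffOn ℝ ∞ F S) {x : ℝ} (hx : x ∈ S) :
    HasDerivWithinAt F (derivWithin F S x) S x :=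
  ((hF.differentiableOn (by simp)) x hx).hasDerivWithinAt

theorem contDiffOn_derivWithin (hS : IsInitialInterval S) {F : ℝ → ℝ} (hF : ContDiffOn ℝ ∞ F S) :
    ContDiffOn ℝ ∞ (derivWithin F S) S :=
  ((contDiffOn_infty_iff_derivWithin hS.uniqueDiffOn).1 hF).2

theorem derivWithin_dilationMean (hS : IsInitialInterval S) (k : ℕ) {F : ℝ → ℝ}
    (hF : ContDiffOn ℝ ∞ F S) :
    EqOn (derivWithin (dilationMean k F) S) (dilationMean (k + 1) (derivWithin F S)) S :=
  fun r hr => (hasDerivWithinAt_dilationMean hS k (contDiffOn_derivWithin hS hF).continuousOn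
    (fun _ hx => hasDerivWithinAt_of_contDiffOn hF hx) hr).derivWithin (hS.uniqueDiffOn r hr)

/-- The derivative of a mean is a mean of the derivative with a higher exponent, so the induction
must run over all `k` and `F` at once. -/
theorem contDiffOn_dilationMean (hS : IsInitialInterval S) (k : ℕ) {F : ℝ → ℝ}
    (hF : ContDiffOn ℝ ∞ F S) : ContDiffOn ℝ ∞ (dilationMean k F) S := by
  refine contDiffOn_infty.2 fun m => ?_
  induction m generalizing k F with
  | zero => exact contDiffOn_zero.2 (continuousOn_dilationMean hS k hF.continuousOn)
  | succ m ih =>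
    have hd := contDiffOn_derivWithin hS hF
    rw [Nat.cast_succ, contDiffOn_succ_iff_derivWithin hS.uniqueDiffOn]
    refine ⟨fun r hr => (hasDerivWithinAt_dilationMean hS k hd.continuousOn
      (fun _ hx => hasDerivWithinAt_of_contDiffOn hF hx) hr).differentiableWithinAt,
      by simp, ?_⟩
    exact (ih (k + 1) hd).congr (derivWithin_dilationMean hS k hF)

/-- The `j`-th derivative of the mean at `0` is `F^{(j)}(0) / (k + j + 1)`. -/
theorem iteratedDerivWithin_dilationMean_zero (hS : IsInitialInterval S) (j k : ℕ) {F : ℝ → ℝ}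
    (hF : ContDiffOn ℝ ∞ F S) (h0 : iteratedDerivWithin j F S 0 = 0) :
    iteratedDerivWithin j (dilationMean k F) S 0 = 0 := by
  induction j generalizing k F with
  | zero =>
    rw [iteratedDerivWithin_zero] at h0 ⊢
    rw [dilationMean_zero, h0, zero_div]
  | succ j ih =>
    rw [iteratedDerivWithin_succ'] at h0 ⊢
    rw [iteratedDerivWithin_congr (derivWithin_dilationMean hS k hF) hS.zero_mem]
    exact ih (k + 1) (contDiffOn_derivWithin hS hF) h0

/-- **Hadamard's lemma** on an initial interval. -/
theorem eq_add_mul_dilationMean (hS : IsInitialInterval S) {F : ℝ → ℝ}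
    (hF : ContDiffOn ℝ ∞ F S) {r : ℝ} (hr : r ∈ S) :
    F r = F 0 + r * dilationMean 0 (derivWithin F S) r := by
  have hr0 := hS.nonneg r hr
  rw [mul_dilationMean_zero,
    intervalIntegral.integral_eq_sub_of_hasDerivAt_of_le (f := F) hr0
      (hF.continuousOn.mono (hS.Icc_subset hr))
      (fun y hy => (hasDerivWithinAt_of_contDiffOn hF
        (hS.Icc_subset hr ⟨hy.1.le, hy.2.le⟩)).hasDerivAt
          (hS.mem_nhds (hS.Icc_subset hr ⟨hy.1.le, hy.2.le⟩) hy.1))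
      (ContinuousOn.intervalIntegrable (by
        rw [uIcc_of_le hr0]
        exact (contDiffOn_derivWithin hS hF).continuousOn.mono (hS.Icc_subset hr)))]
  ring

/-- `t ↦ t ∫₀¹ k(s t) ds` is a primitive of `k`. -/
theorem hasDerivWithinAt_mul_dilationMean (hS : IsInitialInterval S) {F : ℝ → ℝ}
    (hF : ContDiffOn ℝ ∞ F S) {r : ℝ} (hr : r ∈ S) :
    HasDerivWithinAt (fun t => t * dilationMean 0 F t) (F r) S r := by
  rcases (hS.nonneg r hr).eq_or_lt with h0 | h0
  · subst h0
    have := (hasDerivWithinAt_id (0 : ℝ) S).mul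
      (hasDerivWithinAt_of_contDiffOn (contDiffOn_dilationMean hS 0 hF) hr)
    refine this.congr_deriv ?_
    simp [dilationMean_zero]
  · have hc := hF.continuousOn.mono (hS.Icc_subset hr)
    have hn := hS.mem_nhds hr h0
    simp only [mul_dilationMean_zero]
    exact (intervalIntegral.integral_hasDerivAt_right
      (ContinuousOn.intervalIntegrable (by rwa [uIcc_of_le h0.le]))
      (ContinuousOn.stronglyMeasurableAtFilter_nhdsWithin (hF.continuousOn.mono interior_subset)
        isOpen_interior.measurableSet r |>.filter_mono (by
          rw [(isOpen_interior).nhdsWithin_eq (mem_interior_iff_mem_nhds.2 hn)]))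
      (hF.continuousOn.continuousAt hn)).hasDerivWithinAt

/-- **Whitney's theorem** on even functions: a smooth function on `[0, a)` whose odd derivatives
vanish at `0` is a smooth function of `r²`. -/
theorem contDiffOn_comp_sqrt (hS : IsInitialInterval S) {f : ℝ → ℝ} (hf : ContDiffOn ℝ ∞ f S)
    (hodd : ∀ k, iteratedDerivWithin (2 * k + 1) f S 0 = 0) :
    ContDiffOn ℝ ∞ (fun t => f (Real.sqrt t)) {t | 0 ≤ t ∧ Real.sqrt t ∈ S} := by
  have hT := hS.sqrt_preimage
  set T := {t | 0 ≤ t ∧ Real.sqrt t ∈ S} with hTdef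
  refine contDiffOn_infty.2 fun m => ?_
  induction m generalizing f with
  | zero =>
    exact contDiffOn_zero.2
      (hf.continuousOn.comp Real.continuous_sqrt.continuousOn fun t ht => ht.2)
  | succ m ih =>
    have hd := contDiffOn_derivWithin hS hf
    have hd2 := contDiffOn_derivWithin hS hd
    -- As `f'(0) = 0`, Hadamard gives `f'(r) = r g(r)`, so `d/dt f(√t) = g(√t) / 2`. The odd
    -- derivatives of `g` vanish at `0` too, so the induction hypothesis applies to `g`.
    set g := dilationMean 0 (derivWithin (derivWithin f S) S) with hg
    have hgs : ContDiffOn ℝ ∞ g S := contDiffOn_dilationMean hS 0 hd2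
    have hgodd : ∀ k, iteratedDerivWithin (2 * k + 1) g S 0 = 0 := fun k => by
      refine iteratedDerivWithin_dilationMean_zero hS _ _ hd2 ?_
      have := hodd (k + 1)
      rwa [show 2 * (k + 1) + 1 = (2 * k + 1) + 1 + 1 by ring, iteratedDerivWithin_succ',
        iteratedDerivWithin_succ'] at this
    have hf'0 : derivWithin f S 0 = 0 := by
      have := hodd 0
      rwa [mul_zero, zero_add, iteratedDerivWithin_one] at this
    have hf' : ∀ r ∈ S, derivWithin f S r = r * g r := fun r hr => by
      rw [eq_add_mul_dilationMean hS hd hr, hf'0, zero_add]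
    have hpos : ∀ t ∈ T, 0 < t →
        HasDerivAt (fun t => f (Real.sqrt t)) (1 / 2 * g (Real.sqrt t)) t := by
      intro t ht h0
      have hs := Real.sqrt_pos.2 h0
      have h1 := ((hasDerivWithinAt_of_contDiffOn hf ht.2).hasDerivAt (hS.mem_nhds ht.2 hs)).comp t
        (Real.hasDerivAt_sqrt h0.ne')
      refine h1.congr_deriv ?_
      rw [hf' _ ht.2]
      field_simp
    have hcg : ContinuousOn (fun t => 1 / 2 * g (Real.sqrt t)) T :=
      (hgs.continuousOn.comp Real.continuous_sqrt.continuousOn fun t ht => ht.2).const_smul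
        (1 / 2 : ℝ)
    have hcf : ContinuousOn (fun t => f (Real.sqrt t)) T :=
      hf.continuousOn.comp Real.continuous_sqrt.continuousOn fun t ht => ht.2
    have hall : ∀ t ∈ T,
        HasDerivWithinAt (fun t => f (Real.sqrt t)) (1 / 2 * g (Real.sqrt t)) T t := by
      intro t ht
      rcases ht.1.eq_or_lt with h0 | h0
      · subst h0
        obtain ⟨a, haT, ha⟩ := hT.exists_gt 0 hT.zero_mem
        have hsub : Ioo 0 a ⊆ T := Ioo_subset_Icc_self.trans (hT.Icc_subset haT)
        -- `√` is not differentiable at `0`; the one-sided derivative there is the limit of the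
        -- derivatives at positive `t`.
        refine (hasDerivWithinAt_Ici_of_tendsto_deriv (s := Ioo 0 a)
          (fun x hx => ((hpos x (hsub hx) hx.1).differentiableAt).differentiableWithinAt)
          ((hcf 0 ht).mono hsub) (Ioo_mem_nhdsGT ha) ?_).mono fun x hx => hx.1
        have h1 : Tendsto (fun t => 1 / 2 * g (Real.sqrt t)) (𝓝[Ioo 0 a] 0)
            (𝓝 (1 / 2 * g (Real.sqrt 0))) := ((hcg 0 ht).mono hsub)
        rw [nhdsWithin_Ioo_eq_nhdsGT ha] at h1
        refine h1.congr' ?_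
        filter_upwards [Ioo_mem_nhdsGT ha] with x hx using (hpos x (hsub hx) hx.1).deriv.symm
      · exact (hpos t ht h0).hasDerivWithinAt
    rw [Nat.cast_succ, contDiffOn_succ_iff_derivWithin hT.uniqueDiffOn]
    refine ⟨fun t ht => (hall t ht).differentiableWithinAt, by simp, ?_⟩
    exact ((ih hgs hgodd).const_smul (1 / 2 : ℝ)).congr
      fun t ht => (hall t ht).derivWithin (hT.uniqueDiffOn t ht)

/-! ### Extrinsic geometry of rotationally symmetric Killing graphs -/

section Geometry

variable {n : ℕ} {T : Set ℝ}

local notation "𝔼" => EuclideanSpace ℝ (Fin n)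

/-- A one-sided derivative of `f` suffices, even at `x = 0`, because `‖y‖ ^ 2` stays in `T` for all
nearby `y`. -/
theorem hasFDerivAt_comp_norm_sq {f : ℝ → ℝ} {f' : ℝ} {x : 𝔼}
    (hf : HasDerivWithinAt f f' T (‖x‖ ^ 2)) (hT : ∀ᶠ y in 𝓝 x, ‖y‖ ^ 2 ∈ T) :
    HasFDerivAt (fun y : 𝔼 => f (‖y‖ ^ 2)) (f' • ((2 : ℝ) • innerSL ℝ x)) x := by
  have h := (hasStrictFDerivAt_norm_sq x).hasFDerivAt
  have h2 := hf.hasFDerivWithinAt.comp_hasFDerivAt x h hT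
  refine h2.congr_fderiv ?_
  ext v
  simp
  ring

/-- The metric `α ⟨·,·⟩ + β ⟨p, ·⟩² + E ds²`, with `α, β, E` functions of `‖p‖²`. -/
noncomputable def rotationalMetric (α β E : ℝ → ℝ) (p a b : 𝔼 × ℝ) : ℝ :=
  α (‖p.1‖ ^ 2) * inner ℝ a.1 b.1
    + β (‖p.1‖ ^ 2) * (inner ℝ p.1 a.1 * inner ℝ p.1 b.1) + E (‖p.1‖ ^ 2) * (a.2 * b.2)

theorem fderiv_rotationalMetric {α β E : ℝ → ℝ} {α' β' E' : ℝ} {p : 𝔼 × ℝ}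
    (hα : HasDerivWithinAt α α' T (‖p.1‖ ^ 2)) (hβ : HasDerivWithinAt β β' T (‖p.1‖ ^ 2))
    (hE : HasDerivWithinAt E E' T (‖p.1‖ ^ 2)) (hT : ∀ᶠ y in 𝓝 p.1, ‖y‖ ^ 2 ∈ T)
    (a b c : 𝔼 × ℝ) :
    fderiv ℝ (fun q => rotationalMetric α β E q b c) p a
      = 2 * α' * inner ℝ p.1 a.1 * inner ℝ b.1 c.1
        + 2 * β' * inner ℝ p.1 a.1 * (inner ℝ p.1 b.1 * inner ℝ p.1 c.1)
        + β (‖p.1‖ ^ 2)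
          * (inner ℝ a.1 b.1 * inner ℝ p.1 c.1 + inner ℝ p.1 b.1 * inner ℝ a.1 c.1)
        + 2 * E' * inner ℝ p.1 a.1 * (b.2 * c.2) := by
  have hfst : HasFDerivAt (fun q : 𝔼 × ℝ => q.1) (ContinuousLinearMap.fst ℝ 𝔼 ℝ) p :=
    hasFDerivAt_fst
  have h1 := ((hasFDerivAt_comp_norm_sq hα hT).comp p hfst).mul_const (inner ℝ b.1 c.1)
  have hb := hfst.inner ℝ (hasFDerivAt_const b.1 p)
  have hc := hfst.inner ℝ (hasFDerivAt_const c.1 p)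
  have h2 := ((hasFDerivAt_comp_norm_sq hβ hT).comp p hfst).mul (hb.mul hc)
  have h3 := ((hasFDerivAt_comp_norm_sq hE hT).comp p hfst).mul_const (b.2 * c.2)
  have h := (h1.add h2).add h3
  have e : fderiv ℝ (fun q => rotationalMetric α β E q b c) p = _ := h.fderiv
  rw [e]
  simp
  ring

theorem fderiv_graphMap_apply {u U : ℝ → ℝ} {U' : ℝ} {x : 𝔼}
    (hu : ∀ᶠ y : 𝔼 in 𝓝 x, u ‖y‖ = U (‖y‖ ^ 2))
    (hU : HasDerivWithinAt U U' T (‖x‖ ^ 2)) (hT : ∀ᶠ y in 𝓝 x, ‖y‖ ^ 2 ∈ T) (v : 𝔼) :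
    fderiv ℝ (graphMap u) x v = (v, 2 * U' * inner ℝ x v) := by
  have h := (hasFDerivAt_id x).prodMk (hasFDerivAt_comp_norm_sq hU hT)
  have h2 : HasFDerivAt (graphMap u) _ x := h.congr_of_eventuallyEq
    (hu.mono fun y hy => by simp [graphMap, hy])
  rw [h2.fderiv]
  simp
  ring

theorem fderiv_fderiv_graphMap_apply {u V : ℝ → ℝ} {V' : ℝ} {x : 𝔼}
    (hu : ∀ᶠ y : 𝔼 in 𝓝 x, ∀ w,
      fderiv ℝ (graphMap u) y w = (w, 2 * V (‖y‖ ^ 2) * inner ℝ y w))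
    (hV : HasDerivWithinAt V V' T (‖x‖ ^ 2)) (hT : ∀ᶠ y in 𝓝 x, ‖y‖ ^ 2 ∈ T) (v w : 𝔼) :
    fderiv ℝ (fun y => fderiv ℝ (graphMap u) y w) x v
      = (0, 4 * V' * (inner ℝ x v * inner ℝ x w) + 2 * V (‖x‖ ^ 2) * inner ℝ v w) := by
  have h1 := (((hasFDerivAt_comp_norm_sq hV hT).const_mul 2).mul
    ((hasFDerivAt_id x).inner ℝ (hasFDerivAt_const w x)))
  have h := (hasFDerivAt_const w x).prodMk h1
  have h2 : HasFDerivAt (fun y => fderiv ℝ (graphMap u) y w) _ x := h.congr_of_eventuallyEq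
    (hu.mono fun y hy => by simp [hy])
  rw [h2.fderiv]
  simp
  ring

/-- The trace of `I⁻¹ II` when both forms are combinations of `⟨·,·⟩` and `⟨x, ·⟩²`. -/
theorem trace_inv_mul_rotational (x : 𝔼) {a k : ℝ} (P Q : ℝ) (ha : a ≠ 0)
    (hak : a + k * ‖x‖ ^ 2 ≠ 0) :
    ((Matrix.of fun i j : Fin n =>
        a * inner ℝ (EuclideanSpace.single i (1 : ℝ)) (EuclideanSpace.single j (1 : ℝ))
        + k * (inner ℝ x (EuclideanSpace.single i (1 : ℝ))
          * inner ℝ x (EuclideanSpace.single j (1 : ℝ))))⁻¹ *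
      (Matrix.of fun i j : Fin n =>
        P * inner ℝ (EuclideanSpace.single i (1 : ℝ)) (EuclideanSpace.single j (1 : ℝ))
        + Q * (inner ℝ x (EuclideanSpace.single i (1 : ℝ))
          * inner ℝ x (EuclideanSpace.single j (1 : ℝ))))).trace
      = (n - 1) * P / a + (P + Q * ‖x‖ ^ 2) / (a + k * ‖x‖ ^ 2) := by
  set t := ‖x‖ ^ 2 with ht
  have hdot : x.ofLp ⬝ᵥ x.ofLp = t := by
    rw [ht, EuclideanSpace.real_norm_sq_eq]
    simp [dotProduct, sq]
  have key : ∀ c d : ℝ, (Matrix.of fun i j : Fin n =>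
        c * inner ℝ (EuclideanSpace.single i (1 : ℝ)) (EuclideanSpace.single j (1 : ℝ))
        + d * (inner ℝ x (EuclideanSpace.single i (1 : ℝ))
          * inner ℝ x (EuclideanSpace.single j (1 : ℝ))))
      = c • (1 : Matrix (Fin n) (Fin n) ℝ) + d • Matrix.vecMulVec x.ofLp x.ofLp := by
    intro c d
    ext i j
    simp [EuclideanSpace.inner_single_right, Matrix.vecMulVec_apply, Matrix.one_apply,
      eq_comm (a := j)]
  have hmul : ∀ c d c' d' : ℝ,
      (c • (1 : Matrix (Fin n) (Fin n) ℝ) + d • Matrix.vecMulVec x.ofLp x.ofLp)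
        * (c' • (1 : Matrix (Fin n) (Fin n) ℝ) + d' • Matrix.vecMulVec x.ofLp x.ofLp)
      = (c * c') • (1 : Matrix (Fin n) (Fin n) ℝ)
        + (c * d' + d * c' + d * d' * t) • Matrix.vecMulVec x.ofLp x.ofLp := by
    intro c d c' d'
    have h := Matrix.vecMulVec_mul_vecMulVec x.ofLp x.ofLp x.ofLp x.ofLp
    rw [hdot] at h
    simp only [add_mul, mul_add, Matrix.smul_mul, Matrix.mul_smul, one_mul, mul_one, h, smul_smul]
    simp only [Matrix.vecMulVec_smul, smul_smul]
    module
  -- The inverse of a rank-one perturbation of a scalar matrix, by the Sherman–Morrison formula.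
  rw [key, key, Matrix.inv_eq_right_inv
    (B := a⁻¹ • (1 : Matrix (Fin n) (Fin n) ℝ)
      + (-(k / (a * (a + k * t)))) • Matrix.vecMulVec x.ofLp x.ofLp) (by
    rw [hmul]
    have h1 : a * a⁻¹ = 1 := mul_inv_cancel₀ ha
    have h2 : a * -(k / (a * (a + k * t))) + k * a⁻¹ + k * -(k / (a * (a + k * t))) * t = 0 := by
      field_simp
      ring
    rw [h1, h2]
    simp), hmul]
  simp only [Matrix.trace_add, Matrix.trace_smul, Matrix.trace_one, Matrix.trace_vecMulVec, hdot,
    Fintype.card_fin, smul_eq_mul]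
  field_simp
  ring

end Geometry

/-! ### Unit normal and weighted mean curvature -/

section Curvature

variable {n : ℕ} {T : Set ℝ}

local notation "𝔼" => EuclideanSpace ℝ (Fin n)

/-- The upward unit normal of a rotational Killing graph whose slope is `2 V ⟨x, ·⟩`, with
`V = H e^ψ / (2 √(1 - H² r²))`. -/
theorem isUpwardUnitNormal_iff {ξ ψ u α β E V : ℝ → ℝ} {x : 𝔼} {H e q : ℝ}
    (hG : ∀ a b, ambientMetric ξ ψ (graphMap u x) a b
      = rotationalMetric α β E (graphMap u x) a b)
    (hu : ∀ w, fderiv ℝ (graphMap u) x w = (w, 2 * V (‖x‖ ^ 2) * inner ℝ x w))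
    (hα : 0 < α (‖x‖ ^ 2)) (hαβ : α (‖x‖ ^ 2) + β (‖x‖ ^ 2) * ‖x‖ ^ 2 = 1)
    (he : 0 < e) (hE : E (‖x‖ ^ 2) = (e ^ 2)⁻¹) (hq : 0 < q) (hq2 : q ^ 2 = 1 - H ^ 2 * ‖x‖ ^ 2)
    (hV : V (‖x‖ ^ 2) = H * e / (2 * q)) (N : 𝔼 × ℝ) :
    IsUpwardUnitNormal ξ ψ u x N ↔ N = (-H • x, e * q) := by
  have hxx : inner ℝ x x = ‖x‖ ^ 2 := real_inner_self_eq_norm_sq x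
  have hgx : (graphMap u x).1 = x := rfl
  generalize ht : ‖x‖ ^ 2 = t at *
  have hs : ∀ s : ℝ, E t * (s * (2 * V t)) = s * H / (e * q) := fun s => by
    rw [hE, hV]; field_simp
  constructor
  · rintro ⟨h1, h2, h3⟩
    obtain ⟨y, s⟩ := N
    simp only [hG, hu, rotationalMetric, hgx, ht, hE, inner_zero_right, mul_zero, zero_add,
      mul_one] at h1 h2 h3
    have hs0 : 0 < s := by
      by_contra hcon
      have : (e ^ 2)⁻¹ * s ≤ 0 := mul_nonpos_of_nonneg_of_nonpos (by positivity) (by linarith)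
      linarith
    set m := s * H / (e * q) with hm
    -- Orthogonality says `α y + (β ⟨x, y⟩ + m) x = 0`, so `y` is a multiple of `x`. Testing with `v
    -- = x` fixes the multiple.
    have h2' : ∀ v, α t * inner ℝ y v + (β t * inner ℝ x y + m) * inner ℝ x v = 0 := fun v => by
      rw [hm, ← hs, hE]
      linear_combination h2 v
    have hxy : inner ℝ x y = -m * t := by
      have := h2' x
      rw [hxx, real_inner_comm] at this
      linear_combination this - inner ℝ x y * hαβ
    have hy : y = -m • x := by
      refine ext_inner_right ℝ fun v => ?_
      rw [real_inner_smul_left]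
      refine mul_left_cancel₀ hα.ne' ?_
      have := h2' v
      rw [hxy] at this
      linear_combination this + m * inner ℝ x v * hαβ
    have hsq : s ^ 2 = (e * q) ^ 2 := by
      rw [hy] at h1
      simp only [real_inner_smul_left, real_inner_smul_right, hxx] at h1
      have h1' : m ^ 2 * t + (e ^ 2)⁻¹ * s ^ 2 = 1 := by
        linear_combination h1 - m ^ 2 * t * hαβ
      rw [hm] at h1'
      field_simp at h1'
      linear_combination h1' - s ^ 2 * hq2
    have hseq : s = e * q := (sq_eq_sq₀ hs0.le (by positivity)).1 hsq
    have hmH : m = H := by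
      rw [hm, hseq]; field_simp
    rw [hy, hmH, hseq]
  · rintro rfl
    refine ⟨?_, fun v => ?_, ?_⟩
    · simp only [hG, rotationalMetric, hgx, ht, hE, real_inner_smul_left, real_inner_smul_right,
        hxx]
      have : (e ^ 2)⁻¹ * (e * q * (e * q)) = q ^ 2 := by field_simp
      rw [this]
      linear_combination hq2 + H ^ 2 * t * hαβ
    · simp only [hG, hu, rotationalMetric, hgx, ht, real_inner_smul_left, real_inner_smul_right,
        hxx]
      have h : E t * (e * q * (2 * V t)) = H := by
        rw [hs, mul_comm, mul_div_cancel_right₀ _ (by positivity)]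
      linear_combination inner ℝ x v * h - H * inner ℝ x v * hαβ
    · simp only [hG, rotationalMetric, hgx, ht, hE, inner_zero_right, mul_zero, zero_add, mul_one]
      positivity

/-- Primes are derivatives in `t = r²`. `hαβ` says that radial lines have unit speed and `hαβ'` is
its derivative; `hαΨ` encodes `c = 1`; `hdV` is the logarithmic derivative of `V`. With these the
trace of the second fundamental form is `n H + 2 Ψ' H t`, and `dψ(N)` removes the second term. -/
theorem graphWeightedMeanCurvature_eq {ξ ψ u α β Ψ V : ℝ → ℝ} {x : 𝔼} {H α' β' Ψ' e q : ℝ}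
    (hn : n ≠ 0)
    (hG : ∀ᶠ p in 𝓝 (graphMap u x), ∀ a b : 𝔼 × ℝ, ambientMetric ξ ψ p a b
      = rotationalMetric α β (fun t => Real.exp (-2 * Ψ t)) p a b)
    (hψ : ∀ᶠ y : 𝔼 in 𝓝 x, ψ ‖y‖ = Ψ (‖y‖ ^ 2))
    (hu : ∀ᶠ y : 𝔼 in 𝓝 x, ∀ w,
      fderiv ℝ (graphMap u) y w = (w, 2 * V (‖y‖ ^ 2) * inner ℝ y w))
    (hT : ∀ᶠ y in 𝓝 x, ‖y‖ ^ 2 ∈ T)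
    (hdα : HasDerivWithinAt α α' T (‖x‖ ^ 2)) (hdβ : HasDerivWithinAt β β' T (‖x‖ ^ 2))
    (hdΨ : HasDerivWithinAt Ψ Ψ' T (‖x‖ ^ 2))
    (hα : 0 < α (‖x‖ ^ 2)) (hαβ : α (‖x‖ ^ 2) + β (‖x‖ ^ 2) * ‖x‖ ^ 2 = 1)
    (hαβ' : α' + β (‖x‖ ^ 2) + β' * ‖x‖ ^ 2 = 0)
    (hαΨ : 4 * α (‖x‖ ^ 2) * Ψ' = (n - 1) * α')
    (he : e = Real.exp (Ψ (‖x‖ ^ 2))) (hq : 0 < q) (hq2 : q ^ 2 = 1 - H ^ 2 * ‖x‖ ^ 2)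
    (hV : V (‖x‖ ^ 2) = H * e / (2 * q))
    (hdV : HasDerivWithinAt V (H * e / (2 * q) * (Ψ' + H ^ 2 / (2 * q ^ 2))) T (‖x‖ ^ 2)) :
    graphWeightedMeanCurvature ξ ψ u x (-H • x, e * q) = H := by
  have he0 : 0 < e := he ▸ Real.exp_pos _
  have hxx : inner ℝ x x = ‖x‖ ^ 2 := real_inner_self_eq_norm_sq x
  have hgx : (graphMap u x).1 = x := rfl
  have hE : Real.exp (-2 * Ψ (‖x‖ ^ 2)) = (e ^ 2)⁻¹ := by
    rw [he, ← Real.exp_nat_mul, ← Real.exp_neg]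
    congr 1
    push_cast
    ring
  have hdE : HasDerivWithinAt (fun t => Real.exp (-2 * Ψ t)) (-2 * Ψ' * (e ^ 2)⁻¹) T (‖x‖ ^ 2) :=
    (hdΨ.const_mul (-2)).exp.congr_deriv (by rw [hE]; ring)
  have hdG : ∀ a b c : 𝔼 × ℝ, fderiv ℝ (fun p => ambientMetric ξ ψ p b c) (graphMap u x) a
      = fderiv ℝ (fun p => rotationalMetric α β (fun t => Real.exp (-2 * Ψ t)) p b c)
        (graphMap u x) a := fun a b c => by
    have h : (fun p => ambientMetric ξ ψ p b c) =ᶠ[𝓝 (graphMap u x)]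
        (fun p => rotationalMetric α β (fun t => Real.exp (-2 * Ψ t)) p b c) :=
      hG.mono fun p hp => hp b c
    rw [h.fderiv_eq]
  have hdR := fderiv_rotationalMetric (p := graphMap u x) hdα hdβ hdE hT
  have hG0 := hG.self_of_nhds
  have hu0 := hu.self_of_nhds
  have hdψ : fderiv ℝ (fun p : 𝔼 × ℝ => ψ ‖p.1‖) (graphMap u x) (-H • x, e * q)
      = -2 * Ψ' * H * ‖x‖ ^ 2 := by
    have h1 := (hasFDerivAt_comp_norm_sq hdΨ hT).congr_of_eventuallyEq hψ
    have h2 : HasFDerivAt (fun p : 𝔼 × ℝ => ψ ‖p.1‖) _ (graphMap u x) :=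
      HasFDerivAt.comp (graphMap u x) (g := fun y : 𝔼 => ψ ‖y‖) h1 hasFDerivAt_fst
    rw [h2.fderiv]
    simp [real_inner_smul_right]
    ring
  have hI : ∀ v w, inducedMetric (ambientMetric ξ ψ) (graphMap u) x v w
      = α (‖x‖ ^ 2) * inner ℝ v w
        + (β (‖x‖ ^ 2) + H ^ 2 / q ^ 2) * (inner ℝ x v * inner ℝ x w) := fun v w => by
    rw [inducedMetric, hG0, hu0, hu0]
    simp only [rotationalMetric, hgx, hE, hV]
    field_simp
    ring
  have hII : ∀ v w, secondFundamentalForm (ambientMetric ξ ψ) (graphMap u) x (-H • x, e * q) v w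
      = H * (α (‖x‖ ^ 2) + α' * ‖x‖ ^ 2) * inner ℝ v w
        + (-2 * H * Ψ' + H ^ 3 / q ^ 2 - 2 * α' * H - β' * H * ‖x‖ ^ 2
            - 2 * Ψ' * H ^ 3 * ‖x‖ ^ 2 / q ^ 2)
          * (inner ℝ x v * inner ℝ x w) := fun v w => by
    have hwv : inner ℝ w v = inner ℝ v w := real_inner_comm _ _
    have hvx : inner ℝ v x = inner ℝ x v := real_inner_comm _ _
    have hwx : inner ℝ w x = inner ℝ x w := real_inner_comm _ _
    rw [secondFundamentalForm, christoffel, fderiv_fderiv_graphMap_apply hu hdV hT, hdG, hdG, hdG,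
      hdR, hdR, hdR, hG0, hu0, hu0]
    simp only [rotationalMetric, hgx, hE, hV, inner_smul_right, inner_smul_left, inner_zero_left,
      inner_zero_right, hxx, hwv, hvx, hwx, conj_trivial]
    -- Eliminating `α` makes the identity a formal one in the remaining quantities.
    rw [show α (‖x‖ ^ 2) = 1 - β (‖x‖ ^ 2) * ‖x‖ ^ 2 by linarith]
    field_simp
    ring
  rw [graphWeightedMeanCurvature, weightedMeanCurvature, hdψ, meanCurvature]
  simp only [hI, hII]
  -- The radial eigenvalue of the induced metric: `1 + H² t / q² = 1 / q²`.
  have hak : α (‖x‖ ^ 2) + (β (‖x‖ ^ 2) + H ^ 2 / q ^ 2) * ‖x‖ ^ 2 = 1 / q ^ 2 := by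
    field_simp
    linear_combination q ^ 2 * hαβ + hq2
  rw [trace_inv_mul_rotational x _ _ hα.ne' (by rw [hak]; positivity), hak]
  have hPQ : H * (α (‖x‖ ^ 2) + α' * ‖x‖ ^ 2) + (-2 * H * Ψ' + H ^ 3 / q ^ 2 - 2 * α' * H
      - β' * H * ‖x‖ ^ 2 - 2 * Ψ' * H ^ 3 * ‖x‖ ^ 2 / q ^ 2) * ‖x‖ ^ 2
      = H * (1 - 2 * Ψ' * ‖x‖ ^ 2) / q ^ 2 := by
    field_simp
    linear_combination H * (1 - 2 * Ψ' * ‖x‖ ^ 2) * hq2 + H * q ^ 2 * hαβ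
      - H * q ^ 2 * ‖x‖ ^ 2 * hαβ'
  have hP : (n - 1) * (H * (α (‖x‖ ^ 2) + α' * ‖x‖ ^ 2)) / α (‖x‖ ^ 2)
      = (n - 1) * H + 4 * Ψ' * H * ‖x‖ ^ 2 := by
    rw [div_eq_iff hα.ne']
    linear_combination (-H * ‖x‖ ^ 2) * hαΨ
  rw [hP, hPQ]
  have hn' : (n : ℝ) ≠ 0 := Nat.cast_ne_zero.2 hn
  field_simp
  ring

end Curvature

/-! ### The example -/

/-- The warping function of a model manifold is `r` times a positive smooth function of `r²`. -/
theorem IsModelWarping.exists_quotient {R : EReal} {ξ : ℝ → ℝ} (hξ : IsModelWarping R ξ)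
    (hR : 0 < R) :
    ∃ a : ℝ → ℝ, ContDiffOn ℝ ∞ a {t | 0 ≤ t ∧ Real.sqrt t ∈ radialInterval R} ∧ a 0 = 1 ∧
      (∀ t, 0 ≤ t → Real.sqrt t ∈ radialInterval R → 0 < a t) ∧
      ∀ r ∈ radialInterval R, ξ r = r * a (r ^ 2) := by
  have hS := isInitialInterval_radialInterval hR
  have hd := contDiffOn_derivWithin hS hξ.smooth
  have h00 : ξ 0 = 0 := by simpa using hξ.even_deriv 0
  have hmul : ∀ r ∈ radialInterval R,
      ξ r = r * dilationMean 0 (derivWithin ξ (radialInterval R)) r := fun r hr => by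
    rw [eq_add_mul_dilationMean hS hξ.smooth hr, h00, zero_add]
  -- `ξ(r) / r` is the mean of `ξ'` over `[0, r]`; the odd derivatives of `ξ'` at `0` are even
  -- derivatives of `ξ`, so Whitney's theorem applies.
  refine ⟨fun t => dilationMean 0 (derivWithin ξ (radialInterval R)) (Real.sqrt t),
    contDiffOn_comp_sqrt hS (contDiffOn_dilationMean hS 0 hd) fun k =>
      iteratedDerivWithin_dilationMean_zero hS _ _ hd ?_, ?_, fun t ht htS => ?_, fun r hr => ?_⟩
  · rw [← iteratedDerivWithin_succ']
    exact hξ.even_deriv (k + 1)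
  · simp [dilationMean_zero, hξ.deriv_one]
  · rcases ht.eq_or_lt with h0 | h0
    · simp [← h0, dilationMean_zero, hξ.deriv_one]
    · have h1 := hξ.pos _ (Real.sqrt_pos.2 h0) htS.2
      rw [hmul _ htS] at h1
      exact pos_of_mul_pos_right h1 (Real.sqrt_nonneg _)
  · simp only
    rw [Real.sqrt_sq hr.1]
    exact hmul r hr

theorem examplePotential_eq {n : ℕ} {c b : ℝ} {ξ a : ℝ → ℝ} {r : ℝ} (ha0 : a 0 = 1)
    (hr : ξ r = r * a (r ^ 2)) :
    examplePotential n c b ξ r = c * (((n : ℝ) - 1) / 2 * Real.log (a (r ^ 2))) + b := by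
  by_cases h : r = 0
  · simp [examplePotential, h, ha0]
  · rw [examplePotential, if_neg h, hr, mul_div_cancel_left₀ _ h]

theorem modelMetric_eq {n : ℕ} {ξ a β : ℝ → ℝ} {x : EuclideanSpace ℝ (Fin n)} (ha0 : a 0 = 1)
    (hr : ξ ‖x‖ = ‖x‖ * a (‖x‖ ^ 2)) (hβ : a (‖x‖ ^ 2) ^ 2 + β (‖x‖ ^ 2) * ‖x‖ ^ 2 = 1)
    (v w : EuclideanSpace ℝ (Fin n)) :
    modelMetric ξ x v w
      = a (‖x‖ ^ 2) ^ 2 * inner ℝ v w + β (‖x‖ ^ 2) * (inner ℝ x v * inner ℝ x w) := by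
  by_cases h : x = 0
  · simp [modelMetric, h, ha0]
  · have h0 : ‖x‖ ≠ 0 := norm_ne_zero_iff.2 h
    rw [modelMetric, if_neg h, hr, mul_div_cancel_left₀ _ h0]
    field_simp
    linear_combination -(inner ℝ x v * inner ℝ x w) * hβ

/-! ### The height integral -/

theorem hasDerivAt_sqrt_one_sub {H τ : ℝ} (hH : H ≠ 0) (h : 0 < 1 - H ^ 2 * τ ^ 2) :
    HasDerivAt (fun τ => Real.sqrt (1 - H ^ 2 * τ ^ 2) / H)
      (-H * τ / Real.sqrt (1 - H ^ 2 * τ ^ 2)) τ := by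
  have h1 : HasDerivAt (fun τ : ℝ => 1 - H ^ 2 * τ ^ 2) (-(H ^ 2 * (2 * τ))) τ := by
    simpa using ((hasDerivAt_pow 2 τ).const_mul (H ^ 2)).const_sub 1
  refine ((h1.sqrt h.ne').div_const H).congr_deriv ?_
  have := (Real.sqrt_pos.2 h).ne'
  field_simp

theorem one_sub_pos {H r₀ t : ℝ} (hr₀ : 0 < r₀) (hH : H = -1 / r₀) (h : t < r₀ ^ 2) :
    0 < 1 - H ^ 2 * t := by
  have h1 : H ^ 2 * r₀ ^ 2 = 1 := by rw [hH]; field_simp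
  have h2 : 0 < H ^ 2 := by rw [hH]; positivity
  nlinarith

/-- The integrand is unbounded near `r₀`, where `1 - H² r₀² = 0`, but it is a nonnegative derivative
of a function continuous up to the endpoint. -/
theorem intervalIntegrable_slope {H r₀ : ℝ} (hr₀ : 0 < r₀) (hH : H = -1 / r₀) :
    IntervalIntegrable (fun τ => -H * τ / Real.sqrt (1 - H ^ 2 * τ ^ 2)) volume 0 r₀ := by
  have hH0 : H < 0 := by rw [hH]; exact div_neg_of_neg_of_pos (by norm_num) hr₀
  refine intervalIntegral.intervalIntegrable_deriv_of_nonneg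
    (g := fun τ => Real.sqrt (1 - H ^ 2 * τ ^ 2) / H) ?_ (fun τ hτ => ?_) (fun τ hτ => ?_)
  · fun_prop
  all_goals rw [min_eq_left hr₀.le, max_eq_right hr₀.le] at hτ
  · exact hasDerivAt_sqrt_one_sub hH0.ne
      (one_sub_pos hr₀ hH (pow_lt_pow_left₀ hτ.2 hτ.1.le two_ne_zero))
  · exact div_nonneg (mul_nonneg (neg_nonneg.2 hH0.le) hτ.1.le) (Real.sqrt_nonneg _)

theorem intervalIntegrable_heightIntegrand {H r₀ : ℝ} {ψ : ℝ → ℝ} (hr₀ : 0 < r₀)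
    (hH : H = -1 / r₀) (hψ : ContinuousOn ψ (Icc 0 r₀)) :
    IntervalIntegrable (heightIntegrand H ψ) volume 0 r₀ :=
  (intervalIntegrable_slope hr₀ hH).mul_continuousOn (by
    rw [uIcc_of_le hr₀.le]
    exact hψ.rexp)

theorem exampleHeight_bounds {H r₀ r M : ℝ} {ψ : ℝ → ℝ} (hr₀ : 0 < r₀) (hH : H = -1 / r₀)
    (hψ : ContinuousOn ψ (Icc 0 r₀)) (hM : ∀ t ∈ Icc 0 r₀, ψ t ≤ M) (hr : r ∈ Icc 0 r₀) :
    0 ≤ exampleHeight H r₀ ψ r ∧ exampleHeight H r₀ ψ r ≤ Real.exp M * (1 / |H|) := by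
  have hH0 : H < 0 := by rw [hH]; exact div_neg_of_neg_of_pos (by norm_num) hr₀
  have hsub : uIcc r r₀ ⊆ uIcc 0 r₀ := by
    rw [uIcc_of_le hr.2, uIcc_of_le hr₀.le]
    exact Icc_subset_Icc_left hr.1
  have hslope : ∀ τ ∈ Icc r r₀, 0 ≤ -H * τ / Real.sqrt (1 - H ^ 2 * τ ^ 2) := fun τ hτ =>
    div_nonneg (mul_nonneg (neg_nonneg.2 hH0.le) (hr.1.trans hτ.1)) (Real.sqrt_nonneg _)
  have hi1 := (intervalIntegrable_slope hr₀ hH).mono_set hsub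
  have hi2 := (intervalIntegrable_heightIntegrand hr₀ hH hψ).mono_set hsub
  have hint : ∫ τ in r..r₀, -H * τ / Real.sqrt (1 - H ^ 2 * τ ^ 2)
      = Real.sqrt (1 - H ^ 2 * r ^ 2) / |H| := by
    rw [intervalIntegral.integral_eq_sub_of_hasDerivAt_of_le
      (f := fun τ => Real.sqrt (1 - H ^ 2 * τ ^ 2) / H) hr.2 (by fun_prop)
      (fun τ hτ => hasDerivAt_sqrt_one_sub hH0.ne
        (one_sub_pos hr₀ hH (pow_lt_pow_left₀ hτ.2 (hr.1.trans hτ.1.le) two_ne_zero))) hi1]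
    have h1 : H ^ 2 * r₀ ^ 2 = 1 := by rw [hH]; field_simp
    simp only [h1, abs_of_neg hH0, sub_self, Real.sqrt_zero, zero_div, zero_sub, div_neg]
  refine ⟨intervalIntegral.integral_nonneg hr.2 fun τ hτ =>
    mul_nonneg (hslope τ hτ) (Real.exp_pos _).le, ?_⟩
  calc exampleHeight H r₀ ψ r
      ≤ ∫ τ in r..r₀, -H * τ / Real.sqrt (1 - H ^ 2 * τ ^ 2) * Real.exp M :=
        intervalIntegral.integral_mono_on hr.2 hi2 (hi1.mul_const _) fun τ hτ =>
          mul_le_mul_of_nonneg_left (Real.exp_le_exp.2 (hM τ ⟨hr.1.trans hτ.1, hτ.2⟩))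
            (hslope τ hτ)
    _ = Real.exp M * (Real.sqrt (1 - H ^ 2 * r ^ 2) / |H|) := by
        rw [intervalIntegral.integral_mul_const, hint, mul_comm]
    _ ≤ Real.exp M * (1 / |H|) := by
        gcongr
        exact Real.sqrt_le_iff.2
          ⟨zero_le_one, by nlinarith [mul_nonneg (sq_nonneg H) (sq_nonneg r)]⟩

/-- `Ω` is an open ball while the extrema are taken on `[0, r₀]`; by continuity, bounds on `[0, r₀)`
pass to the closure. -/
theorem isLUB_image_Ico {r₀ M : ℝ} {f : ℝ → ℝ} (hr₀ : 0 < r₀) (hf : ContinuousOn f (Icc 0 r₀))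
    (hM : IsLUB (f '' Icc 0 r₀) M) : IsLUB (f '' Ico 0 r₀) M := by
  refine ⟨upperBounds_mono_set (image_mono Ico_subset_Icc_self) hM.1, fun b hb => hM.2 ?_⟩
  rintro _ ⟨x, hx, rfl⟩
  rw [← closure_Ico hr₀.ne] at hx hf
  exact ContinuousWithinAt.closure_le hx ((hf x hx).mono subset_closure)
    continuousWithinAt_const fun y hy => hb ⟨y, hy, rfl⟩

theorem isGLB_image_Ico {r₀ m : ℝ} {f : ℝ → ℝ} (hr₀ : 0 < r₀) (hf : ContinuousOn f (Icc 0 r₀))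
    (hm : IsGLB (f '' Icc 0 r₀) m) : IsGLB (f '' Ico 0 r₀) m := by
  refine ⟨lowerBounds_mono_set (image_mono Ico_subset_Icc_self) hm.1, fun b hb => hm.2 ?_⟩
  rintro _ ⟨x, hx, rfl⟩
  rw [← closure_Ico hr₀.ne] at hx hf
  exact ContinuousWithinAt.closure_le hx continuousWithinAt_const
    ((hf x hx).mono subset_closure) fun y hy => hb ⟨y, hy, rfl⟩

/-- As `n ≥ 1`, every nonnegative number is the norm of a vector. -/
theorem image_norm_ball {n : ℕ} (hn : 1 ≤ n) (r₀ : ℝ) (f : ℝ → ℝ) :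
    (fun x : EuclideanSpace ℝ (Fin n) => f ‖x‖) '' Metric.ball 0 r₀ = f '' Ico 0 r₀ := by
  ext y
  constructor
  · rintro ⟨x, hx, rfl⟩
    exact ⟨‖x‖, ⟨norm_nonneg x, mem_ball_zero_iff.1 hx⟩, rfl⟩
  · rintro ⟨r, hr, rfl⟩
    have h : ‖EuclideanSpace.single (⟨0, hn⟩ : Fin n) r‖ = r := by
      simp [abs_of_nonneg hr.1]
    exact ⟨EuclideanSpace.single ⟨0, hn⟩ r, by rw [mem_ball_zero_iff, h]; exact hr.2, by
      simp only [h]⟩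

/-- The slope of the height function with respect to `r²`. -/
noncomputable def squareSlope (H : ℝ) (Ψ : ℝ → ℝ) (t : ℝ) : ℝ :=
  H * Real.exp (Ψ t) / (2 * Real.sqrt (1 - H ^ 2 * t))

theorem hasDerivWithinAt_squareSlope {H t Ψ' : ℝ} {Ψ : ℝ → ℝ} {T : Set ℝ}
    (hΨ : HasDerivWithinAt Ψ Ψ' T t) (h : 0 < 1 - H ^ 2 * t) :
    HasDerivWithinAt (squareSlope H Ψ)
      (H * Real.exp (Ψ t) / (2 * Real.sqrt (1 - H ^ 2 * t))
        * (Ψ' + H ^ 2 / (2 * Real.sqrt (1 - H ^ 2 * t) ^ 2))) T t := by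
  have h1 : HasDerivWithinAt (fun t : ℝ => 1 - H ^ 2 * t) (-(H ^ 2)) T t := by
    simpa using ((hasDerivWithinAt_id t T).const_mul (H ^ 2)).const_sub 1
  have hq := (Real.sqrt_pos.2 h).ne'
  refine ((hΨ.exp.const_mul H).div ((h1.sqrt h.ne').const_mul 2) (by positivity)).congr_deriv ?_
  field_simp
  ring

theorem contDiffOn_squareSlope {H : ℝ} {Ψ : ℝ → ℝ} {Q : Set ℝ} (hΨ : ContDiffOn ℝ ∞ Ψ Q)
    (h : ∀ t ∈ Q, 0 < 1 - H ^ 2 * t) : ContDiffOn ℝ ∞ (squareSlope H Ψ) Q := by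
  refine ContDiffOn.div (contDiffOn_const.mul hΨ.exp) (contDiffOn_const.mul
    (ContDiffOn.sqrt (contDiffOn_const.sub (contDiffOn_const.mul contDiffOn_id))
      fun t ht => (h t ht).ne')) fun t ht => ?_
  have := Real.sqrt_pos.2 (h t ht)
  positivity

/-- The height function is a function of `r²`, with slope `squareSlope`. -/
theorem exampleHeight_eq {H r₀ r : ℝ} {ψ Ψ : ℝ → ℝ} (hr₀ : 0 < r₀) (hH : H = -1 / r₀)
    (hψ : ContinuousOn ψ (Icc 0 r₀)) (hΨ : ContDiffOn ℝ ∞ Ψ (Ico 0 (r₀ ^ 2)))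
    (hψΨ : ∀ r ∈ Icc 0 r₀, ψ r = Ψ (r ^ 2)) (hr : r ∈ Ico 0 r₀) :
    exampleHeight H r₀ ψ r
      = exampleHeight H r₀ ψ 0 + r ^ 2 * dilationMean 0 (squareSlope H Ψ) (r ^ 2) := by
  have hi := intervalIntegrable_heightIntegrand hr₀ hH hψ
  have hr2 : r ^ 2 ∈ Ico 0 (r₀ ^ 2) := ⟨sq_nonneg r, pow_lt_pow_left₀ hr.2 hr.1 two_ne_zero⟩
  have h0r : uIcc 0 r ⊆ uIcc 0 r₀ := by
    rw [uIcc_of_le hr.1, uIcc_of_le hr₀.le]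
    exact Icc_subset_Icc_right hr.2.le
  have hrr : uIcc r r₀ ⊆ uIcc 0 r₀ := by
    rw [uIcc_of_le hr.2.le, uIcc_of_le hr₀.le]
    exact Icc_subset_Icc_left hr.1
  have hsplit := intervalIntegral.integral_add_adjacent_intervals (hi.mono_set h0r)
    (hi.mono_set hrr)
  -- Substitution `t = τ²`. The sign appears because the integrand carries `-H` and `squareSlope`
  -- carries `H`.
  have hsub : ∫ τ in (0 : ℝ)..r, heightIntegrand H ψ τ
      = -∫ t in (0 : ℝ)..r ^ 2, squareSlope H Ψ t := by
    have hc := (contDiffOn_squareSlope hΨ fun t ht => one_sub_pos hr₀ hH ht.2).continuousOn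
    have h := intervalIntegral.integral_comp_mul_deriv'' (a := 0) (b := r)
      (f := fun τ : ℝ => τ ^ 2) (f' := fun τ => 2 * τ) (g := squareSlope H Ψ)
      (by fun_prop) (fun τ _ => by simpa using (hasDerivAt_pow 2 τ).hasDerivWithinAt)
      (by fun_prop) (hc.mono (by
        rintro _ ⟨τ, hτ, rfl⟩
        rw [uIcc_of_le hr.1] at hτ
        exact ⟨sq_nonneg τ, pow_lt_pow_left₀ (hτ.2.trans_lt hr.2) hτ.1 two_ne_zero⟩))
    simp only [Function.comp, ne_eq, OfNat.ofNat_ne_zero, not_false_eq_true, zero_pow] at h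
    rw [← h, ← intervalIntegral.integral_neg]
    refine intervalIntegral.integral_congr fun τ hτ => ?_
    rw [uIcc_of_le hr.1] at hτ
    have hτ1 : τ ∈ Icc 0 r₀ := ⟨hτ.1, hτ.2.trans hr.2.le⟩
    have hq := Real.sqrt_pos.2 (one_sub_pos hr₀ hH
      (pow_lt_pow_left₀ (hτ.2.trans_lt hr.2) hτ.1 two_ne_zero))
    simp only [heightIntegrand, squareSlope, hψΨ τ hτ1]
    field_simp
  rw [mul_dilationMean_zero]
  unfold exampleHeight
  linear_combination hsplit - hsub

end KillingGraph

/-! ### Assembly of the main theorem -/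

theorem mainTheorem10 (n : ℕ) (hn : 1 ≤ n) (R : EReal) (ξ : ℝ → ℝ)
    (hξ : KillingGraph.IsModelWarping R ξ) (c b : ℝ) (hc : 0 < c)
    (r₀ : ℝ) (hr₀ : 0 < r₀) (hr₀R : (r₀ : EReal) < R) (H₀ : ℝ) (hH₀ : H₀ = -1 / r₀)
    (ψ u : ℝ → ℝ) (hψ : ψ = KillingGraph.examplePotential n c b ξ)
    (hu : u = KillingGraph.exampleHeight H₀ r₀ ψ)
    (Ω : Set (EuclideanSpace ℝ (Fin n))) (hΩ : Ω = Metric.ball 0 r₀) :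
    -- `ψ` is smooth and even, and defines a smooth function on `P`
    ContDiffOn ℝ ∞ (fun r : ℝ => ψ |r|) {r : ℝ | ((|r| : ℝ) : EReal) < R} ∧
    ContDiffOn ℝ ∞ (fun x : EuclideanSpace ℝ (Fin n) => ψ ‖x‖) (KillingGraph.modelBall n R) ∧
    -- `u` is well defined by a convergent integral, and defines a smooth function on `Ω`
    IntervalIntegrable (KillingGraph.heightIntegrand H₀ ψ) MeasureTheory.volume 0 r₀ ∧
    ContDiffOn ℝ ∞ (fun x : EuclideanSpace ℝ (Fin n) => u ‖x‖) Ω ∧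
    -- for `c = 1` the Killing graph of `u` over `Ω` has constant weighted mean curvature `H₀`
    -- with respect to the upward pointing unit normal
    (c = 1 → ∀ x ∈ Ω,
      (∃! N, KillingGraph.IsUpwardUnitNormal ξ ψ u x N) ∧
      ∀ N, KillingGraph.IsUpwardUnitNormal ξ ψ u x N →
        KillingGraph.graphWeightedMeanCurvature ξ ψ u x N = H₀) ∧
    -- the height estimate
    (∀ r ∈ Icc 0 r₀,
      0 ≤ Real.exp (-ψ r) * u r ∧
      Real.exp (-ψ r) * u r ≤
        sSup ((fun t => Real.exp (-ψ t)) '' Icc 0 r₀) /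
          sInf ((fun t => Real.exp (-ψ t)) '' Icc 0 r₀) * (1 / |H₀|)) ∧
    sSup ((fun t => Real.exp (-ψ t)) '' Icc 0 r₀) /
        sInf ((fun t => Real.exp (-ψ t)) '' Icc 0 r₀) =
      Real.exp (sSup ((fun x => ψ ‖x‖) '' Ω) - sInf ((fun x => ψ ‖x‖) '' Ω)) := by
  have hR : 0 < R := lt_of_le_of_lt (by exact_mod_cast hr₀.le) hr₀R
  have hS := KillingGraph.isInitialInterval_radialInterval hR
  have hT := hS.sqrt_preimage
  obtain ⟨a, ha, ha0, hapos, hξa⟩ := hξ.exists_quotient hR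
  set S := KillingGraph.radialInterval R with hSdef
  set T := {t : ℝ | 0 ≤ t ∧ Real.sqrt t ∈ S} with hTdef
  have hr₀S : r₀ ∈ S := ⟨hr₀.le, hr₀R⟩
  have hsqT : ∀ r ∈ S, r ^ 2 ∈ T := fun r hr => ⟨sq_nonneg r, by rwa [Real.sqrt_sq hr.1]⟩
  have hsub : Ico 0 (r₀ ^ 2) ⊆ T := Ico_subset_Icc_self.trans (hT.Icc_subset (hsqT r₀ hr₀S))
  -- the potential as a smooth function of `r²`
  set Ψ : ℝ → ℝ := fun t => c * (((n : ℝ) - 1) / 2 * Real.log (a t)) + b with hΨdef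
  have hΨ : ContDiffOn ℝ ∞ Ψ T := (contDiffOn_const.mul (contDiffOn_const.mul
    (ha.log fun t ht => (hapos t ht.1 ht.2).ne'))).add contDiffOn_const
  have hψΨ : ∀ r ∈ S, ψ r = Ψ (r ^ 2) := fun r hr => by
    rw [hψ, KillingGraph.examplePotential_eq ha0 (hξa r hr)]
  have hIccS : Icc 0 r₀ ⊆ S := hS.Icc_subset hr₀S
  have hψc : ContinuousOn ψ (Icc 0 r₀) :=
    (hΨ.continuousOn.comp (continuous_pow 2).continuousOn
      fun r hr => hsqT r (hIccS hr)).congr fun r hr => hψΨ r (hIccS hr)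
  have hballS : ∀ x ∈ Ω, ‖x‖ ∈ S := fun x hx => by
    rw [hΩ, mem_ball_zero_iff] at hx
    exact hIccS ⟨norm_nonneg x, hx.le⟩
  -- the height as a smooth function of `r²`
  set V := KillingGraph.squareSlope H₀ Ψ with hVdef
  have hQ := KillingGraph.isInitialInterval_Ico (pow_pos hr₀ 2)
  have hV : ContDiffOn ℝ ∞ V (Ico 0 (r₀ ^ 2)) := KillingGraph.contDiffOn_squareSlope
    (hΨ.mono hsub) fun t ht => KillingGraph.one_sub_pos hr₀ hH₀ ht.2
  set U : ℝ → ℝ := fun t => u 0 + t * KillingGraph.dilationMean 0 V t with hUdef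
  have hUs : ContDiffOn ℝ ∞ U (Ico 0 (r₀ ^ 2)) :=
    contDiffOn_const.add (contDiffOn_id.mul (KillingGraph.contDiffOn_dilationMean hQ 0 hV))
  have hUd : ∀ t ∈ Ico 0 (r₀ ^ 2), HasDerivWithinAt U (V t) (Ico 0 (r₀ ^ 2)) t := fun t ht =>
    (KillingGraph.hasDerivWithinAt_mul_dilationMean hQ hV ht).const_add _
  have huU : ∀ x ∈ Ω, u ‖x‖ = U (‖x‖ ^ 2) := fun x hx => by
    rw [hΩ, mem_ball_zero_iff] at hx
    rw [hUdef, hu]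
    exact KillingGraph.exampleHeight_eq hr₀ hH₀ hψc (hΨ.mono hsub)
      (fun r hr => hψΨ r (hIccS hr)) ⟨norm_nonneg x, hx⟩
  have hΩQ : ∀ x ∈ Ω, ‖x‖ ^ 2 ∈ Ico 0 (r₀ ^ 2) := fun x hx => by
    rw [hΩ, mem_ball_zero_iff] at hx
    exact ⟨sq_nonneg _, pow_lt_pow_left₀ hx (norm_nonneg x) two_ne_zero⟩
  have hΩo : IsOpen Ω := hΩ ▸ Metric.isOpen_ball
  -- extrema of the potential
  obtain ⟨r₁, hr₁, hmax⟩ := isCompact_Icc.exists_isMaxOn (nonempty_Icc.2 hr₀.le) hψc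
  obtain ⟨r₂, hr₂, hmin⟩ := isCompact_Icc.exists_isMinOn (nonempty_Icc.2 hr₀.le) hψc
  have hlub : IsLUB (ψ '' Icc 0 r₀) (ψ r₁) :=
    IsGreatest.isLUB ⟨mem_image_of_mem ψ hr₁, by rintro _ ⟨r, hr, rfl⟩; exact hmax hr⟩
  have hglb : IsGLB (ψ '' Icc 0 r₀) (ψ r₂) :=
    IsLeast.isGLB ⟨mem_image_of_mem ψ hr₂, by rintro _ ⟨r, hr, rfl⟩; exact hmin hr⟩
  have hsup : sSup ((fun t => Real.exp (-ψ t)) '' Icc 0 r₀) = Real.exp (-ψ r₂) :=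
    IsGreatest.csSup_eq ⟨⟨r₂, hr₂, rfl⟩, by
      rintro _ ⟨r, hr, rfl⟩; exact Real.exp_le_exp.2 (neg_le_neg (hmin hr))⟩
  have hinf : sInf ((fun t => Real.exp (-ψ t)) '' Icc 0 r₀) = Real.exp (-ψ r₁) :=
    IsLeast.csInf_eq ⟨⟨r₁, hr₁, rfl⟩, by
      rintro _ ⟨r, hr, rfl⟩; exact Real.exp_le_exp.2 (neg_le_neg (hmax hr))⟩
  have hratio : sSup ((fun t => Real.exp (-ψ t)) '' Icc 0 r₀) /
      sInf ((fun t => Real.exp (-ψ t)) '' Icc 0 r₀) = Real.exp (-ψ r₂) * Real.exp (ψ r₁) := by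
    rw [hsup, hinf, Real.exp_neg (ψ r₁), div_inv_eq_mul]
  refine ⟨?_, ?_, KillingGraph.intervalIntegrable_heightIntegrand hr₀ hH₀ hψc, ?_, ?_, ?_, ?_⟩
  · refine (hΨ.comp (contDiff_id.pow 2).contDiffOn fun r hr =>
      ⟨sq_nonneg r, by rw [id, Real.sqrt_sq_eq_abs]; exact ⟨abs_nonneg r, hr⟩⟩).congr
      fun r hr => ?_
    rw [hψΨ |r| ⟨abs_nonneg r, hr⟩, sq_abs]
    rfl
  · exact (hΨ.comp (contDiff_norm_sq ℝ).contDiffOn fun x hx => hsqT _ ⟨norm_nonneg x, hx⟩).congr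
      fun x hx => hψΨ _ ⟨norm_nonneg x, hx⟩
  · exact (hUs.comp (contDiff_norm_sq ℝ).contDiffOn hΩQ).congr huU
  · intro hc1 x hx
    set α : ℝ → ℝ := fun t => a t ^ 2 with hαdef
    have hα : ContDiffOn ℝ ∞ α T := ha.pow 2
    have hdα := KillingGraph.contDiffOn_derivWithin hT hα
    -- This is `(1 - α) / t`, written through Hadamard's lemma so that it is smooth up to `t = 0`;
    -- it uses `α 0 = 1`.
    set β : ℝ → ℝ := fun t => -KillingGraph.dilationMean 0 (derivWithin α T) t with hβdef
    have hβ : ContDiffOn ℝ ∞ β T := (KillingGraph.contDiffOn_dilationMean hT 0 hdα).neg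
    have hαβ : ∀ t ∈ T, α t + β t * t = 1 := fun t ht => by
      rw [KillingGraph.eq_add_mul_dilationMean hT hα ht, hβdef]
      simp only [hαdef, ha0]
      ring
    have hxT := hsub (hΩQ x hx)
    have hΩn : ∀ᶠ y in nhds x, y ∈ Ω := hΩo.eventually_mem hx
    have hΩT : ∀ᶠ y in nhds x, ‖y‖ ^ 2 ∈ T := hΩn.mono fun y hy => hsub (hΩQ y hy)
    have hG : ∀ p : EuclideanSpace ℝ (Fin n) × ℝ, p.1 ∈ Ω → ∀ v w,
        KillingGraph.ambientMetric ξ ψ p v w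
          = KillingGraph.rotationalMetric α β (fun t => Real.exp (-2 * Ψ t)) p v w := by
      intro p hp v w
      rw [KillingGraph.ambientMetric, KillingGraph.rotationalMetric, hψΨ _ (hballS _ hp),
        KillingGraph.modelMetric_eq ha0 (hξa _ (hballS _ hp))
          (hαβ _ (hsub (hΩQ _ hp)))]
    have hgu : ∀ y ∈ Ω, ∀ w, fderiv ℝ (KillingGraph.graphMap u) y w
        = (w, 2 * V (‖y‖ ^ 2) * inner ℝ y w) := fun y hy =>
      KillingGraph.fderiv_graphMap_apply
        ((hΩo.eventually_mem hy).mono fun z hz => huU z hz) (hUd _ (hΩQ y hy))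
        ((hΩo.eventually_mem hy).mono fun z hz => hΩQ z hz)
    have hpos : 0 < 1 - H₀ ^ 2 * ‖x‖ ^ 2 := KillingGraph.one_sub_pos hr₀ hH₀ (hΩQ x hx).2
    have hq := Real.sqrt_pos.2 hpos
    have hq2 := Real.sq_sqrt hpos.le
    have hax := hapos _ hxT.1 hxT.2
    have hαx : 0 < α (‖x‖ ^ 2) := pow_pos hax 2
    have hda := KillingGraph.hasDerivWithinAt_of_contDiffOn ha hxT
    have hdαx : HasDerivWithinAt α _ T (‖x‖ ^ 2) := hda.pow 2
    have hdΨx : HasDerivWithinAt Ψ _ T (‖x‖ ^ 2) :=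
      ((((hda.log hax.ne').const_mul (((n : ℝ) - 1) / 2)).const_mul c).add_const b)
    have hdβx := KillingGraph.hasDerivWithinAt_of_contDiffOn hβ hxT
    have hE : Real.exp (-2 * Ψ (‖x‖ ^ 2)) = (Real.exp (Ψ (‖x‖ ^ 2)) ^ 2)⁻¹ := by
      rw [← Real.exp_nat_mul, ← Real.exp_neg]
      congr 1
      push_cast
      ring
    have hN := KillingGraph.isUpwardUnitNormal_iff (hG (KillingGraph.graphMap u x) hx) (hgu x hx)
      hαx (hαβ _ hxT) (Real.exp_pos _) hE hq hq2 rfl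
    refine ⟨⟨_, (hN _).2 rfl, fun N h => (hN N).1 h⟩, fun N h => ?_⟩
    rw [(hN N).1 h]
    refine KillingGraph.graphWeightedMeanCurvature_eq (V := V) (by omega)
      (((hΩo.preimage continuous_fst).eventually_mem
        (show KillingGraph.graphMap u x ∈ Prod.fst ⁻¹' Ω from hx)).mono fun p hp => hG p hp)
      (hΩn.mono fun y hy => hψΨ _ (hballS y hy)) (hΩn.mono hgu) hΩT hdαx hdβx hdΨx hαx
      (hαβ _ hxT) ?_ ?_ rfl hq hq2 rfl (KillingGraph.hasDerivWithinAt_squareSlope hdΨx hpos)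
    -- Differentiate `α + β t = 1` within `T`; unique differentiability covers the endpoint `t = 0`.
    · have h1 := (hdαx.add (hdβx.mul (hasDerivWithinAt_id _ _))).congr_of_mem
        (f₁ := fun _ => (1 : ℝ)) (fun t ht => (hαβ t ht).symm) hxT
      have h2 := (hT.uniqueDiffOn _ hxT).eq_deriv _ h1 (hasDerivWithinAt_const _ _ _)
      simp only [id] at h2
      linear_combination h2
    -- The only use of `c = 1`: `Ψ' = (n - 1) a' / (2 a)` and `α' = 2 a a'`.
    · rw [hc1]
      simp only [hαdef]
      field_simp
      ring
  · intro r hr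
    obtain ⟨h1, h2⟩ := KillingGraph.exampleHeight_bounds hr₀ hH₀ hψc (fun t ht => hmax ht) hr
    rw [← hu] at h1 h2
    refine ⟨mul_nonneg (Real.exp_pos _).le h1, ?_⟩
    rw [hratio, mul_assoc]
    exact mul_le_mul (Real.exp_le_exp.2 (neg_le_neg (hmin hr))) h2 h1 (Real.exp_pos _).le
  · have hne : (ψ '' Ico 0 r₀).Nonempty := (nonempty_Ico.2 hr₀).image ψ
    rw [hratio, hΩ, KillingGraph.image_norm_ball hn,
      (KillingGraph.isLUB_image_Ico hr₀ hψc hlub).csSup_eq hne,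
      (KillingGraph.isGLB_image_Ico hr₀ hψc hglb).csInf_eq hne, ← Real.exp_add]
    congr 1
    ring
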